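/- For a context-free grammar $G$, a derivation tree of $G$ is an ordered tree whose root is labelled by the start symbol, whose inner nodes are labelled by nonterminals and expanded according to rules of $G$, and whose leaves are labelled by terminals (a node expanded by a rule with empty right-hand side has no children and yields the empty word). $G$ is unambiguous (a UCFG) if every word of $L(G)$ has exactly one derivation tree. A language is inherently ambiguous if it is context-free but is not generated by any unambiguous context-free grammar. **Proposition.** Over the alphabet $\{a,b\}$, the infinite language $$L=\{(a+b)^k\,a\,(a+b)^n\,a\,(a+b)^{n-k}\mid k,n\in\mathbb{N},\ k\le n\},$$ that is, the set of all words $u\,a\,v\,a\,w$ with $u,v,w\in\{a,b\}^*$ and $|v|=|u|+|w|$, is inherently ambiguous: it is context-free, but there is no unambiguous context-free grammar that generates it. -/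

import Mathlib

/-- The two-letter alphabet `{a, b}`. -/
inductive Letter where
  | a : Letter
  | b : Letter
  deriving DecidableEq

namespace ContextFreeGrammar

/-- Ordered forests of derivation trees of `g`, indexed by the list of the labels of their roots.
A root labelled by a terminal is a leaf; a root labelled by a nonterminal carries a rule of `g` for
that nonterminal, and its children, from left to right, form a forest whose roots are labelled by
the right-hand side of that rule. -/
inductive DerivationForest {T : Type*} (g : ContextFreeGrammar T) :
    List (Symbol T g.NT) → Type _ where
  /-- The empty forest. -/
  | nil : DerivationForest g []
  /-- A leaf labelled `t`, followed by the trees of `rest`. -/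
  | leaf (t : T) {s : List (Symbol T g.NT)} (rest : DerivationForest g s) :
      DerivationForest g (Symbol.terminal t :: s)
  /-- A tree whose root is expanded by the rule `r`, followed by the trees of `rest`. -/
  | node (r : ContextFreeRule T g.NT) (hr : r ∈ g.rules)
      (children : DerivationForest g r.output)
      {s : List (Symbol T g.NT)} (rest : DerivationForest g s) :
      DerivationForest g (Symbol.nonterminal r.input :: s)

/-- The word read off the leaves of a forest from left to right. -/
def DerivationForest.yield {T : Type*} {g : ContextFreeGrammar T} :
    {s : List (Symbol T g.NT)} → DerivationForest g s → List T
  | _, .nil => []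
  | _, .leaf t rest => t :: rest.yield
  | _, .node _ _ children rest => children.yield ++ rest.yield

/-- A (complete) derivation tree of `g`: one tree, whose root is labelled by the initial
nonterminal and all of whose leaves are terminals or expanded by an empty right-hand side. -/
abbrev DerivationTree {T : Type*} (g : ContextFreeGrammar T) :=
  DerivationForest g [Symbol.nonterminal g.initial]

/-- `g` is unambiguous if every word of its language has a unique derivation tree. -/
def IsUnambiguous {T : Type*} (g : ContextFreeGrammar T) : Prop :=
  ∀ w ∈ g.language, ∃! d : DerivationTree g, d.yield = w

end ContextFreeGrammar

/-- A language is inherently ambiguous if it is context-free and no unambiguous context-free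
grammar generates it. -/
def Language.IsInherentlyAmbiguous {T : Type*} (L : Language T) : Prop :=
  L.IsContextFree ∧ ¬ ∃ g : ContextFreeGrammar T, g.IsUnambiguous ∧ g.language = L

/-- The language `{a}`. -/
def langA : Language Letter := {[Letter.a]}

/-- The language `a + b` of the two one-letter words. -/
def langAB : Language Letter := {[Letter.a]} + {[Letter.b]}

/-- The language `{(a+b)^k a (a+b)^n a (a+b)^(n-k) | k, n ∈ ℕ, k ≤ n}`. -/
def langL : Language Letter :=
  {w | ∃ k n : ℕ, k ≤ n ∧ w ∈ langAB ^ k * langA * langAB ^ n * langA * langAB ^ (n - k)}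

/-! Let W(p,q,r,s) = b^p a b^q a b^r a b^s a. Apart from degenerate cases, where one exponent is the
sum of the others plus two, W(p,q,r,s) lies in L iff q+r = p+s (first and third `a` chosen) or r+s =
p+q (second and fourth). Iterating a pump many times shows that its increments obey the same
equation as the word it was found in.

If q is large compared with p and r, Ogden's lemma with excluded positions (`exists_pump_of_lt`, in
the form `exists_block_pump`) yields a pump that meets the second block and avoids the first, the
third and all `a`s. The equation then forces it to pair the second block with the fourth. A pump
meeting the first block cannot be paired with the third, because the two subtrees would cross
(`not_crossing`). So it is paired with the second block if q+r = p+s, and with the fourth if r+s =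
p+q.

With K = n!, trees of W(n,z,n+K,z+K) and W(n,z+K,n+K,z) are pumped in these two ways to trees of the
same word W(n+K,z+K,n+K,z+K). In an unambiguous grammar they coincide, so a single tree contains
both pumps; using each once more leaves the language. Spans of nodes are measured in `a`s, so that
inserting `b`s does not alter them. -/

theorem List.count_cons_eq_count_singleton_add {T : Type*} [DecidableEq T] (a t : T)
    (l : List T) : (t :: l).count a = [t].count a + l.count a := by
  rw [← List.singleton_append, List.count_append]

/-! ### Derivation forests and the spans of their nodes. -/

namespace ContextFreeGrammar

namespace DerivationForest

variable {T : Type*} {g : ContextFreeGrammar T}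

/-- Concatenation of forests. -/
def append : {s₁ : List (Symbol T g.NT)} → DerivationForest g s₁ →
    {s₂ : List (Symbol T g.NT)} → DerivationForest g s₂ → DerivationForest g (s₁ ++ s₂)
  | _, .nil, _, e => e
  | _, .leaf t rest, _, e => .leaf t (rest.append e)
  | _, .node r hr c rest, _, e => .node r hr c (rest.append e)

theorem yield_append {s₁ s₂ : List (Symbol T g.NT)} (d : DerivationForest g s₁)
    (e : DerivationForest g s₂) : (d.append e).yield = d.yield ++ e.yield := by
  induction d with
  | nil => rfl
  | leaf t rest ih => simp [append, yield, ih]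
  | node r hr c rest ihc ih => simp [append, yield, ih]

theorem derives_yield {s : List (Symbol T g.NT)} (d : DerivationForest g s) :
    g.Derives s (d.yield.map Symbol.terminal) := by
  induction d with
  | nil => exact Derives.refl _
  | leaf t rest ih => simpa [yield] using ih.append_left [Symbol.terminal t]
  | @node r hr c s rest ihc ih =>
    have h₁ : g.Produces (Symbol.nonterminal r.input :: s) (r.output ++ s) := ⟨r, hr, .head s⟩
    have h₂ := ih.append_left (c.yield.map Symbol.terminal)
    simpa [yield] using h₁.trans_derives ((ihc.append_right s).trans h₂)

theorem yield_mem_language (d : DerivationTree g) : d.yield ∈ g.language :=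
  d.derives_yield

variable [DecidableEq T] (a : T)

/-- The inner nodes of a forest, each given by its label together with the number of occurrences
of `a` to the left of its subtree and the number of those to the left of the right end of its
subtree; `o` occurrences of `a` are supposed to precede the forest. -/
def spans : {s : List (Symbol T g.NT)} → DerivationForest g s → ℕ → Set (g.NT × ℕ × ℕ)
  | _, .nil, _ => ∅
  | _, .leaf t rest, o => rest.spans (o + [t].count a)
  | _, .node r _ c rest, o =>
    insert (r.input, o, o + c.yield.count a)
      (c.spans o ∪ rest.spans (o + c.yield.count a))

theorem spans_append {s₁ s₂ : List (Symbol T g.NT)} (d : DerivationForest g s₁)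
    (e : DerivationForest g s₂) (o : ℕ) :
    (d.append e).spans a o = d.spans a o ∪ e.spans a (o + d.yield.count a) := by
  induction d generalizing o with
  | nil => simp [append, spans, yield]
  | leaf t rest ih =>
    simp only [append, spans, ih, yield]
    rw [List.count_cons_eq_count_singleton_add a t rest.yield, add_assoc]
  | node r hr c rest ihc ih =>
    simp only [append, spans, ih, yield, List.count_append, Set.insert_union, Set.union_assoc,
      add_assoc]

theorem le_of_mem_spans {s : List (Symbol T g.NT)} (d : DerivationForest g s) {o : ℕ}
    {A : g.NT} {i j : ℕ} (h : (A, i, j) ∈ d.spans a o) :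
    o ≤ i ∧ i ≤ j ∧ j ≤ o + d.yield.count a := by
  induction d generalizing o with
  | nil => simp [spans] at h
  | leaf t rest ih =>
    have := ih h
    rw [yield, List.count_cons_eq_count_singleton_add]
    omega
  | node r hr c rest ihc ih =>
    simp only [yield, List.count_append]
    simp only [spans, Set.mem_insert_iff, Prod.mk.injEq, Set.mem_union] at h
    rcases h with ⟨-, rfl, rfl⟩ | h | h
    · omega
    · have := ihc h
      omega
    · have := ih h
      omega

/-- Subtrees are nested or disjoint, so that their spans do not cross. -/
theorem not_crossing {s : List (Symbol T g.NT)} (d : DerivationForest g s) {o : ℕ}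
    {A B : g.NT} {i j i' j' : ℕ} (h : (A, i, j) ∈ d.spans a o) (h' : (B, i', j') ∈ d.spans a o) :
    ¬ (i < i' ∧ i' < j ∧ j < j') := by
  induction d generalizing o with
  | nil => simp [spans] at h
  | leaf t rest ih => exact ih h h'
  | node r hr c rest ihc ih =>
    simp only [spans, Set.mem_insert_iff, Prod.mk.injEq, Set.mem_union] at h h'
    rcases h with ⟨-, rfl, rfl⟩ | h | h <;> rcases h' with ⟨-, rfl, rfl⟩ | h' | h'
    · omega
    · have := le_of_mem_spans a c h'
      omega
    · have := le_of_mem_spans a rest h'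
      omega
    · have := le_of_mem_spans a c h
      omega
    · exact ihc h h'
    · have := le_of_mem_spans a c h
      have := le_of_mem_spans a rest h'
      omega
    · have := le_of_mem_spans a rest h
      omega
    · have := le_of_mem_spans a rest h
      have := le_of_mem_spans a c h'
      omega
    · exact ih h h'

end DerivationForest

/-! ### Contexts and their insertion into a tree. -/

open DerivationForest

variable {T : Type*} {g : ContextFreeGrammar T} [DecidableEq T] (a : T)

/-- The forests with root labels `s` and one leaf `B` have a member with the yield `l B r`: every
tree with root `B` extends to a forest, with the nodes of the tree among those of the forest. -/
def HasContext (g : ContextFreeGrammar T) (s : List (Symbol T g.NT)) (B : g.NT)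
    (l r : List T) : Prop :=
  ∀ t : DerivationForest g [Symbol.nonterminal B], ∃ d : DerivationForest g s,
    d.yield = l ++ t.yield ++ r ∧ ∀ o, t.spans a (o + l.count a) ⊆ d.spans a o

namespace HasContext

variable {a} {s : List (Symbol T g.NT)} {A B : g.NT} {l r l' r' : List T}

theorem refl (A : g.NT) : HasContext a g [Symbol.nonterminal A] A [] [] :=
  fun t => ⟨t, by simp, by simp⟩

theorem trans (h : HasContext a g s A l r)
    (h' : HasContext a g [Symbol.nonterminal A] B l' r') :
    HasContext a g s B (l ++ l') (r' ++ r) := by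
  intro t
  obtain ⟨t', ht', hs'⟩ := h' t
  obtain ⟨d, hd, hs⟩ := h t'
  refine ⟨d, by simp [hd, ht'], fun o => ?_⟩
  rw [List.count_append, ← add_assoc]
  exact (hs' _).trans (hs o)

theorem leaf (t : T) (h : HasContext a g s B l r) :
    HasContext a g (Symbol.terminal t :: s) B (t :: l) r := by
  intro u
  obtain ⟨d, hd, hs⟩ := h u
  refine ⟨.leaf t d, by simp [yield, hd], fun o => ?_⟩
  rw [List.count_cons_eq_count_singleton_add, ← add_assoc]
  exact hs _

theorem child {ρ : ContextFreeRule T g.NT} (hρ : ρ ∈ g.rules)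
    (h : HasContext a g ρ.output B l r) (rest : DerivationForest g s) :
    HasContext a g (Symbol.nonterminal ρ.input :: s) B l (r ++ rest.yield) := by
  intro u
  obtain ⟨d, hd, hs⟩ := h u
  refine ⟨.node ρ hρ d rest, by simp [yield, hd], fun o => ?_⟩
  exact (hs o).trans fun x hx => Or.inr (Or.inl hx)

theorem sibling {ρ : ContextFreeRule T g.NT} (hρ : ρ ∈ g.rules)
    (c : DerivationForest g ρ.output) (h : HasContext a g s B l r) :
    HasContext a g (Symbol.nonterminal ρ.input :: s) B (c.yield ++ l) r := by
  intro u
  obtain ⟨d, hd, hs⟩ := h u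
  refine ⟨.node ρ hρ c d, by simp [yield, hd], fun o => ?_⟩
  rw [List.count_append, ← add_assoc]
  exact (hs _).trans fun x hx => Or.inr (Or.inr hx)

/-- A context around `A` with root `A` can be iterated. -/
theorem iterate {b : T} {x y : ℕ}
    (h : HasContext a g [Symbol.nonterminal A] A (List.replicate x b) (List.replicate y b))
    (k : ℕ) : HasContext a g [Symbol.nonterminal A] A (List.replicate (k * x) b)
      (List.replicate (k * y) b) := by
  induction k with
  | zero => simpa using refl A
  | succ k ih =>
    have := ih.trans h
    rwa [List.replicate_append_replicate, List.replicate_append_replicate, Nat.add_comm y,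
      ← Nat.succ_mul, ← Nat.succ_mul] at this

/-- A context with root `A` around `A` that is free of `a` can be inserted at each node labelled `A`
of a forest, and all nodes of the forest survive. -/
theorem insert {α β : List T} (h : HasContext a g [Symbol.nonterminal A] A α β)
    (hα : α.count a = 0) (hβ : β.count a = 0) (d : DerivationForest g s) {o i j : ℕ}
    (hd : (A, i, j) ∈ d.spans a o) :
    ∃ d' : DerivationForest g s, ∃ l m r : List T, d.yield = l ++ m ++ r ∧
      d'.yield = l ++ α ++ m ++ β ++ r ∧ i = o + l.count a ∧ j = i + m.count a ∧
      d.spans a o ⊆ d'.spans a o := by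
  induction d generalizing o with
  | nil => simp [spans] at hd
  | leaf t rest ih =>
    obtain ⟨d', l, m, r, h₁, h₂, h₃, h₄, h₅⟩ := ih hd
    refine ⟨.leaf t d', t :: l, m, r, by simp [yield, h₁], by simp [yield, h₂], ?_, h₄, h₅⟩
    rw [h₃, List.count_cons_eq_count_singleton_add a t l, add_assoc]
  | node ρ hρ c rest ihc ih =>
    simp only [spans, Set.mem_insert_iff, Prod.mk.injEq, Set.mem_union] at hd
    rcases hd with ⟨rfl, rfl, rfl⟩ | hd | hd
    · obtain ⟨t', ht', hs'⟩ := h (.node ρ hρ c .nil)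
      refine ⟨t'.append rest, [], c.yield, rest.yield, by simp [yield], ?_, by simp, by simp, ?_⟩
      · rw [yield_append, ht']
        simp [yield]
      -- The insertion adds no `a`, so the root keeps its span and everything to its right keeps its
      -- offset.
      · have hc : t'.yield.count a = c.yield.count a := by simp [ht', yield, hα, hβ]
        have := hs' i
        rw [hα, add_zero] at this
        erw [spans_append]
        rw [hc]
        simp only [spans, Set.union_empty] at this
        simp only [spans]
        rw [← Set.insert_union]
        exact Set.union_subset_union_left _ this
    · obtain ⟨d', l, m, r, h₁, h₂, h₃, h₄, h₅⟩ := ihc hd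
      have hc : d'.yield.count a = c.yield.count a := by simp [h₁, h₂, hα, hβ]
      refine ⟨.node ρ hρ d' rest, l, m, r ++ rest.yield, by simp [yield, h₁], by simp [yield, h₂],
        h₃, h₄, ?_⟩
      simp only [spans, hc]
      exact Set.insert_subset_insert (Set.union_subset_union_left _ h₅)
    · obtain ⟨d', l, m, r, h₁, h₂, h₃, h₄, h₅⟩ := ih hd
      refine ⟨.node ρ hρ c d', c.yield ++ l, m, r, by simp [yield, h₁], by simp [yield, h₂],
        by rw [h₃, List.count_append, add_assoc], h₄, ?_⟩
      simp only [spans]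
      exact Set.insert_subset_insert (Set.union_subset_union_right _ h₅)

end HasContext

end ContextFreeGrammar

/-! ### Ogden's lemma with excluded positions. -/

namespace ContextFreeGrammar

open DerivationForest

variable {T : Type*} {g : ContextFreeGrammar T} [DecidableEq T] (a : T)

/-- Some node of the forest satisfies `P`, which may depend on its label and on the positions of the
ends of its yield, if the yield of the forest starts at position `o`. -/
def HasNode {s : List (Symbol T g.NT)} (d : DerivationForest g s) (o : ℕ)
    (P : g.NT → ℕ → ℕ → Prop) : Prop :=
  ∃ (B : g.NT) (l m r : List T), d.yield = l ++ m ++ r ∧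
    (∀ n, (B, n + l.count a, n + l.count a + m.count a) ∈ d.spans a n) ∧
    HasContext a g s B l r ∧ P B (o + l.length) (o + l.length + m.length)

/-- The forest has two nested nodes with the same label such that the part of the yield between
them has a distinguished position and no excluded one. Here `D x` and `E x` are the numbers of
distinguished and of excluded positions before `x`, and the yield of the forest starts at position
`o`. -/
def HasPump (D E : ℕ → ℕ) {s : List (Symbol T g.NT)} (d : DerivationForest g s) (o : ℕ) : Prop :=
  ∃ (A : g.NT) (l α m β r : List T), d.yield = l ++ α ++ m ++ β ++ r ∧
    (∀ n, (A, n + (l ++ α).count a, n + (l ++ α).count a + m.count a) ∈ d.spans a n) ∧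
    HasContext a g [Symbol.nonterminal A] A α β ∧
    E (o + (l ++ α).length) ≤ E (o + l.length) ∧
    E (o + (l ++ α ++ m ++ β).length) ≤ E (o + (l ++ α ++ m).length) ∧
    (D (o + l.length) < D (o + (l ++ α).length) ∨
      D (o + (l ++ α ++ m).length) < D (o + (l ++ α ++ m ++ β).length))

variable {a} {D E : ℕ → ℕ} {s : List (Symbol T g.NT)} {o : ℕ} {P : g.NT → ℕ → ℕ → Prop}
  {ρ : ContextFreeRule T g.NT} (hρ : ρ ∈ g.rules)

theorem HasNode.leaf (t : T) {d : DerivationForest g s} (h : HasNode a d (o + 1) P) :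
    HasNode a (.leaf t d) o P := by
  obtain ⟨B, l, m, r, h₁, h₂, h₃, h₄⟩ := h
  refine ⟨B, t :: l, m, r, by simp [yield, h₁], fun n => ?_, h₃.leaf t, ?_⟩
  · rw [List.count_cons_eq_count_singleton_add, ← add_assoc]
    exact h₂ _
  · rwa [List.length_cons, add_comm l.length, ← add_assoc]

theorem HasNode.child {c : DerivationForest g ρ.output} (h : HasNode a c o P)
    (rest : DerivationForest g s) : HasNode a (.node ρ hρ c rest) o P := by
  obtain ⟨B, l, m, r, h₁, h₂, h₃, h₄⟩ := h
  exact ⟨B, l, m, r ++ rest.yield, by simp [yield, h₁], fun n => Or.inr (Or.inl (h₂ n)),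
    h₃.child hρ rest, h₄⟩

theorem HasNode.sibling (c : DerivationForest g ρ.output) {rest : DerivationForest g s}
    (h : HasNode a rest (o + c.yield.length) P) : HasNode a (.node ρ hρ c rest) o P := by
  obtain ⟨B, l, m, r, h₁, h₂, h₃, h₄⟩ := h
  refine ⟨B, c.yield ++ l, m, r, by simp [yield, h₁], fun n => ?_, h₃.sibling hρ c, ?_⟩
  · rw [List.count_append, ← add_assoc]
    exact Or.inr (Or.inr (h₂ _))
  · rwa [List.length_append, ← add_assoc]

/-- Lets the bound for single trees be applied to the first tree of a forest. -/
theorem HasNode.append_tree {c : DerivationForest g ρ.output}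
    (h : HasNode a (.node ρ hρ c .nil) o P) (rest : DerivationForest g s) :
    HasNode a (.node ρ hρ c rest) o P := by
  obtain ⟨B, l, m, r, h₁, h₂, h₃, h₄⟩ := h
  refine ⟨B, l, m, r ++ rest.yield, ?_, fun n => ?_, fun t => ?_, h₄⟩
  · simp only [yield, List.append_nil] at h₁
    simp [yield, h₁]
  · have := h₂ n
    simp only [spans, Set.union_empty] at this
    simp only [spans]
    rw [← Set.insert_union]
    exact Or.inl this
  · obtain ⟨d, hd, hs⟩ := h₃ t
    refine ⟨d.append rest, ?_, fun n => ?_⟩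
    · rw [yield_append, hd]
      simp
    · erw [spans_append]
      exact Set.subset_union_of_subset_left (hs n) _

theorem HasPump.leaf (t : T) {d : DerivationForest g s} (h : HasPump a D E d (o + 1)) :
    HasPump a D E (.leaf t d) o := by
  obtain ⟨A, l, α, m, β, r, h₁, h₂, h₃, h₄⟩ := h
  refine ⟨A, t :: l, α, m, β, r, by simp [yield, h₁], fun n => ?_, h₃, ?_⟩
  · rw [List.cons_append, List.count_cons_eq_count_singleton_add, ← add_assoc]
    exact h₂ _
  · simpa only [List.length_append, List.length_cons, add_assoc, add_comm, add_left_comm] using h₄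

theorem HasPump.child {c : DerivationForest g ρ.output} (h : HasPump a D E c o)
    (rest : DerivationForest g s) : HasPump a D E (.node ρ hρ c rest) o := by
  obtain ⟨A, l, α, m, β, r, h₁, h₂, h₃⟩ := h
  exact ⟨A, l, α, m, β, r ++ rest.yield, by simp [yield, h₁],
    fun n => Or.inr (Or.inl (h₂ n)), h₃⟩

theorem HasPump.sibling (c : DerivationForest g ρ.output) {rest : DerivationForest g s}
    (h : HasPump a D E rest (o + c.yield.length)) : HasPump a D E (.node ρ hρ c rest) o := by
  obtain ⟨A, l, α, m, β, r, h₁, h₂, h₃, h₄⟩ := h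
  refine ⟨A, c.yield ++ l, α, m, β, r, by simp [yield, h₁], fun n => ?_, h₃, ?_⟩
  · rw [List.append_assoc, List.count_append, ← add_assoc]
    exact Or.inr (Or.inr (h₂ _))
  · simpa only [List.length_append, add_assoc] using h₄

theorem HasPump.append_tree {c : DerivationForest g ρ.output}
    (h : HasPump a D E (.node ρ hρ c .nil) o) (rest : DerivationForest g s) :
    HasPump a D E (.node ρ hρ c rest) o := by
  obtain ⟨A, l, α, m, β, r, h₁, h₂, h₃⟩ := h
  refine ⟨A, l, α, m, β, r ++ rest.yield, ?_, fun n => ?_, h₃⟩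
  · simp only [yield, List.append_nil] at h₁
    simp [yield, h₁]
  · have := h₂ n
    simp only [spans, Set.union_empty] at this
    simp only [spans]
    rw [← Set.insert_union]
    exact Or.inl this

/-- If a node with the label of the root of a tree has all excluded positions of the tree in its
yield, but not all distinguished ones, then the two nodes form a pump. -/
theorem HasPump.of_root {c : DerivationForest g ρ.output} (hD : Monotone D) (hE : Monotone E)
    (h : HasNode a c o fun B x y => B = ρ.input ∧
      E y - E x = E (o + c.yield.length) - E o ∧ D y - D x < D (o + c.yield.length) - D o) :
    HasPump a D E (.node ρ hρ c .nil : DerivationForest g [Symbol.nonterminal ρ.input]) o := by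
  obtain ⟨B, l, m, r, h₁, h₂, h₃, rfl, h₄, h₅⟩ := h
  refine ⟨ρ.input, [], l, m, r, [], by simp [yield, h₁], fun n => Or.inr (Or.inl (h₂ n)), ?_, ?_⟩
  · simpa [yield] using h₃.child hρ .nil
  · have hl : o + c.yield.length = o + l.length + m.length + r.length := by simp [h₁, add_assoc]
    rw [hl] at h₄ h₅
    simp only [List.nil_append, List.length_nil, add_zero, List.length_append, ← add_assoc]
    have e₁ := hE (show o ≤ o + l.length by omega)
    have e₂ := hE (show o + l.length ≤ o + l.length + m.length by omega)
    have e₃ := hE (show o + l.length + m.length ≤ o + l.length + m.length + r.length by omega)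
    have d₁ := hD (show o ≤ o + l.length by omega)
    have d₂ := hD (show o + l.length ≤ o + l.length + m.length by omega)
    have d₃ := hD (show o + l.length + m.length ≤ o + l.length + m.length + r.length by omega)
    omega

variable [DecidableEq g.NT] {L : Finset g.NT} {K : ℕ}

/-- The bound on trees that follows from a bound on the forest below the root. -/
theorem tree_pump_or_bound (hD : Monotone D) (hE : Monotone E) (hL : ρ.input ∈ L)
    (hK : ρ.output.length ≤ K) {c : DerivationForest g ρ.output}
    (hc : ∀ (o : ℕ), ∀ S ⊆ L, ∀ A ∈ L, A ∉ S → ∀ δ e : ℕ, E (o + c.yield.length) - E o ≤ e →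
      D (o + c.yield.length) - D o ≤ δ → HasPump a D E c o ∨
        HasNode a c o (fun B x y => B ∈ S ∧ E y - E x = e) ∨
        HasNode a c o (fun B x y => B = A ∧ E y - E x = e ∧ D y - D x < δ) ∨
        δ ≤ K ^ (e * (L.card + 1) + (L \ S).card) ∨
        D (o + c.yield.length) - D o ≤
          ρ.output.length * K ^ (e * (L.card + 1) + (L \ S).card - 1))
    (o : ℕ) {S : Finset g.NT} (hS : S ⊆ L) :
    HasPump a D E (.node ρ hρ c .nil : DerivationForest g [Symbol.nonterminal ρ.input]) o ∨
    HasNode a (.node ρ hρ c .nil : DerivationForest g [Symbol.nonterminal ρ.input]) o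
      (fun B x y => B ∈ S ∧ E y - E x = E (o + c.yield.length) - E o) ∨
    D (o + c.yield.length) - D o ≤
      K ^ ((E (o + c.yield.length) - E o) * (L.card + 1) + (L \ S).card) := by
  by_cases hA : ρ.input ∈ S
  · refine Or.inr (Or.inl ⟨ρ.input, [], c.yield, [], by simp [yield], fun n => Or.inl rfl,
      HasContext.refl _, hA, by simp⟩)
  · rcases hc o S hS _ hL hA _ _ le_rfl le_rfl with h | h | h | h | h
    · exact Or.inl (h.child hρ .nil)
    · exact Or.inr (Or.inl (h.child hρ .nil))
    · exact Or.inl (.of_root hρ hD hE h)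
    · exact Or.inr (Or.inr h)
    · refine Or.inr (Or.inr (h.trans ?_))
      -- The root label lies in `L \ S`, so the subtraction in the exponent is not truncated and the
      -- factor `K` restores it.
      have : 0 < (L \ S).card := Finset.card_pos.2 ⟨_, Finset.mem_sdiff.2 ⟨hL, hA⟩⟩
      calc _ ≤ K * _ := Nat.mul_le_mul_right _ hK
        _ = _ := by rw [← pow_succ']; congr 1; omega

/-- The forest is thought of as lying below a root labelled `A` whose tree has `e` excluded and `δ`
distinguished positions. `S` collects labels of earlier ancestors: a node with such a label and all
`e` excluded positions closes a pump higher up, as does a node `A` with fewer than `δ` distinguished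
positions. The exponent is a potential: it drops when an excluded position is lost or when `A` joins
`S`. If neither happens, the subtree carries all `δ` distinguished positions, and its own bound is a
bound on `δ`. -/
theorem forest_pump_or_bound (hD : Monotone D) (hE : Monotone E) (hD' : ∀ x, D (x + 1) ≤ D x + 1)
    (hL : ∀ ρ ∈ g.rules, ρ.input ∈ L) (hK : ∀ ρ ∈ g.rules, ρ.output.length ≤ K) (hK' : 0 < K)
    (d : DerivationForest g s) (o : ℕ) (S : Finset g.NT) (hS : S ⊆ L) (A : g.NT) (hA : A ∈ L)
    (hAS : A ∉ S) (δ e : ℕ) (he : E (o + d.yield.length) - E o ≤ e)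
    (hδ : D (o + d.yield.length) - D o ≤ δ) :
    HasPump a D E d o ∨ HasNode a d o (fun B x y => B ∈ S ∧ E y - E x = e) ∨
      HasNode a d o (fun B x y => B = A ∧ E y - E x = e ∧ D y - D x < δ) ∨
      δ ≤ K ^ (e * (L.card + 1) + (L \ S).card) ∨
      D (o + d.yield.length) - D o ≤ s.length * K ^ (e * (L.card + 1) + (L \ S).card - 1) := by
  induction d generalizing o S A δ e with
  | nil => simp [yield]
  | leaf t rest ih =>
    have hl : o + (DerivationForest.leaf t rest).yield.length = o + 1 + rest.yield.length := by
      simp only [yield, List.length_cons]; omega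
    rw [hl] at he hδ ⊢
    have h₁ := hE (show o ≤ o + 1 by omega)
    have h₂ := hD (show o ≤ o + 1 by omega)
    rcases ih (o + 1) S hS A hA hAS δ e (by omega) (by omega) with h | h | h | h | h
    · exact Or.inl (h.leaf t)
    · exact Or.inr (Or.inl (h.leaf t))
    · exact Or.inr (Or.inr (Or.inl (h.leaf t)))
    · exact Or.inr (Or.inr (Or.inr (Or.inl h)))
    · refine Or.inr (Or.inr (Or.inr (Or.inr ?_)))
      have := hD' o
      have : 0 < K ^ (e * (L.card + 1) + (L \ S).card - 1) := pow_pos hK' _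
      rw [List.length_cons, Nat.succ_mul]
      omega
  | @node ρ hρ c s rest ihc ih =>
    have hl : o + (DerivationForest.node ρ hρ c rest).yield.length =
        o + c.yield.length + rest.yield.length := by
      simp only [yield, List.length_append]; omega
    rw [hl] at he hδ ⊢
    have e₁ := hE (show o ≤ o + c.yield.length by omega)
    have e₂ := hE (show o + c.yield.length ≤ o + c.yield.length + rest.yield.length by omega)
    have d₁ := hD (show o ≤ o + c.yield.length by omega)
    have d₂ := hD (show o + c.yield.length ≤ o + c.yield.length + rest.yield.length by omega)
    rcases ih (o + c.yield.length) S hS A hA hAS δ e (by omega) (by omega) with h | h | h | h | h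
    · exact Or.inl (h.sibling hρ c)
    · exact Or.inr (Or.inl (h.sibling hρ c))
    · exact Or.inr (Or.inr (Or.inl (h.sibling hρ c)))
    · exact Or.inr (Or.inr (Or.inr (Or.inl h)))
    have tree := fun {S : Finset g.NT} => tree_pump_or_bound (a := a) (S := S) hρ hD hE (hL ρ hρ)
      (hK ρ hρ) ihc o
    set et := E (o + c.yield.length) - E o with het
    set δt := D (o + c.yield.length) - D o with hδt
    have hcard : 0 < (L \ S).card := Finset.card_pos.2 ⟨_, Finset.mem_sdiff.2 ⟨hA, hAS⟩⟩
    suffices H : HasPump a D E (.node ρ hρ c rest) o ∨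
        HasNode a (.node ρ hρ c rest) o (fun B x y => B ∈ S ∧ E y - E x = e) ∨
        HasNode a (.node ρ hρ c rest) o (fun B x y => B = A ∧ E y - E x = e ∧ D y - D x < δ) ∨
        δ ≤ K ^ (e * (L.card + 1) + (L \ S).card) ∨
        δt ≤ K ^ (e * (L.card + 1) + (L \ S).card - 1) by
      rcases H with H | H | H | H | H
      · exact Or.inl H
      · exact Or.inr (Or.inl H)
      · exact Or.inr (Or.inr (Or.inl H))
      · exact Or.inr (Or.inr (Or.inr (Or.inl H)))
      · refine Or.inr (Or.inr (Or.inr (Or.inr ?_)))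
        rw [List.length_cons, Nat.succ_mul]
        omega
    -- If the subtree misses an excluded position, `S` is reset to `∅`: the lost unit of `e` is
    -- worth `L.card + 1` in the exponent, which pays for the reset and one level.
    rcases lt_or_eq_of_le (show et ≤ e by omega) with hlt | heq
    · rcases tree (Finset.empty_subset L) with h' | ⟨B, l, m, r, -, -, -, h', -⟩ | h'
      · exact Or.inl (h'.append_tree hρ rest)
      · simp at h'
      · refine Or.inr (Or.inr (Or.inr (Or.inr (h'.trans (Nat.pow_le_pow_right hK' ?_)))))
        have : (et + 1) * (L.card + 1) ≤ e * (L.card + 1) := Nat.mul_le_mul_right _ hlt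
        rw [Nat.succ_mul] at this
        rw [Finset.sdiff_empty]
        omega
    -- If only distinguished positions are lost, `A` joins `S`: a node `A` found in the subtree has
    -- fewer than `δ` of them.
    · rcases lt_or_eq_of_le (show δt ≤ δ by omega) with hlt' | heq'
      · have hSA : insert A S ⊆ L := Finset.insert_subset hA hS
        rcases tree hSA with h' | h' | h'
        · exact Or.inl (h'.append_tree hρ rest)
        · obtain ⟨B, l, m, r, h₁, h₂, h₃, h₄, h₅⟩ := h'
          rcases Finset.mem_insert.1 h₄ with rfl | h₄
          · refine Or.inr (Or.inr (Or.inl (HasNode.append_tree hρ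
              ⟨B, l, m, r, h₁, h₂, h₃, rfl, by omega, ?_⟩ rest)))
            have hll : c.yield.length = l.length + m.length + r.length := by
              simpa [yield, add_assoc] using congrArg List.length h₁
            have := hD (show o ≤ o + l.length by omega)
            have := hD (show o + l.length + m.length ≤ o + c.yield.length by omega)
            omega
          · exact Or.inr (Or.inl (HasNode.append_tree hρ
              ⟨B, l, m, r, h₁, h₂, h₃, h₄, by omega⟩ rest))
        · refine Or.inr (Or.inr (Or.inr (Or.inr (h'.trans_eq ?_))))
          have h₁ := Finset.card_sdiff_add_card_eq_card hS
          have h₂ := Finset.card_sdiff_add_card_eq_card hSA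
          rw [Finset.card_insert_of_notMem hAS] at h₂
          congr 1
          rw [heq]
          omega
      · rcases tree hS with h' | h' | h'
        · exact Or.inl (h'.append_tree hρ rest)
        · rw [heq] at h'
          exact Or.inr (Or.inl (h'.append_tree hρ rest))
        · rw [heq, heq'] at h'
          exact Or.inr (Or.inr (Or.inr (Or.inl h')))

/-- **Ogden's lemma** with excluded positions (Bader and Moura), for derivation trees. -/
theorem exists_pump_of_lt (g : ContextFreeGrammar T) (a : T) : ∃ F : ℕ → ℕ, ∀ (D E : ℕ → ℕ),
    Monotone D → Monotone E → (∀ x, D (x + 1) ≤ D x + 1) → D 0 = 0 → E 0 = 0 →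
    ∀ d : DerivationTree g, F (E d.yield.length) < D d.yield.length → HasPump a D E d 0 := by
  classical
  set L := g.rules.image ContextFreeRule.input
  set K := g.rules.sup (fun ρ => ρ.output.length) + 1
  refine ⟨fun e => K ^ (e * (L.card + 1) + L.card), fun D E hD hE hD' hD₀ hE₀ d h => ?_⟩
  replace h : K ^ (E d.yield.length * (L.card + 1) + L.card) < D d.yield.length := h
  have hL : ∀ ρ ∈ g.rules, ρ.input ∈ L := fun ρ hρ => Finset.mem_image_of_mem _ hρ
  have hK : ∀ ρ ∈ g.rules, ρ.output.length ≤ K := fun ρ hρ =>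
    (Finset.le_sup (f := fun ρ : ContextFreeRule T g.NT => ρ.output.length) hρ).trans
      (Nat.le_succ _)
  suffices H : ∀ (s : List (Symbol T g.NT)) (d : DerivationForest g s), s.length = 1 →
      K ^ (E d.yield.length * (L.card + 1) + L.card) < D d.yield.length → HasPump a D E d 0 from
    H _ d rfl h
  intro s d hs h
  cases d with
  | nil => simp at hs
  | leaf t rest =>
    obtain rfl : _ = [] := List.length_eq_zero_iff.1 (by simpa using hs)
    cases rest
    have := hD' 0
    have : 0 < K ^ (E 1 * (L.card + 1) + L.card) := pow_pos (Nat.succ_pos _) _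
    simp only [yield, List.length_cons, List.length_nil, zero_add] at *
    omega
  | node ρ hρ c rest =>
    obtain rfl : _ = [] := List.length_eq_zero_iff.1 (by simpa using hs)
    cases rest
    simp only [yield, List.append_nil] at h
    rcases tree_pump_or_bound (a := a) (K := K) hρ hD hE (hL ρ hρ) (hK ρ hρ)
      (forest_pump_or_bound hD hE hD' hL hK (Nat.succ_pos _) c) 0 (Finset.empty_subset L) with
      h' | ⟨B, l, m, r, -, -, -, h', -⟩ | h'
    · exact h'
    · simp at h'
    · simp only [zero_add, hE₀, hD₀, Nat.sub_zero, Finset.sdiff_empty] at h'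
      omega

end ContextFreeGrammar
-- Blocks of `b`s and pumps in the words W(p,q,r,s).
open ContextFreeGrammar DerivationForest

/-- The number of occurrences of `b` that are preceded by exactly `k` occurrences of `a`. -/
def bBlock : List Letter → ℕ → ℕ
  | [], _ => 0
  | .b :: w, 0 => bBlock w 0 + 1
  | .b :: w, k + 1 => bBlock w (k + 1)
  | .a :: _, 0 => 0
  | .a :: w, k + 1 => bBlock w k

@[simp]
theorem count_replicate_b (x : ℕ) : (List.replicate x Letter.b).count .a = 0 :=
  List.count_eq_zero.2 fun h => Letter.noConfusion (List.eq_of_mem_replicate h)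

theorem bBlock_append (u v : List Letter) (k : ℕ) : bBlock (u ++ v) k =
    bBlock u k + if u.count .a ≤ k then bBlock v (k - u.count .a) else 0 := by
  induction u generalizing k with
  | nil => simp [bBlock]
  | cons t u ih =>
    cases t <;> cases k <;> simp [bBlock, ih, add_right_comm]

theorem bBlock_replicate_b (x k : ℕ) :
    bBlock (List.replicate x .b) k = if k = 0 then x else 0 := by
  induction x with
  | zero => simp [bBlock]
  | succ x ih => cases k <;> simp_all [List.replicate_succ, bBlock]

/-- Reduces the identification of a pumped word to arithmetic on its exponents. -/
theorem eq_of_bBlock_eq {u v : List Letter} (h : u.count .a = v.count .a)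
    (h' : ∀ k, bBlock u k = bBlock v k) : u = v := by
  induction u generalizing v with
  | nil =>
    cases v with
    | nil => rfl
    | cons t v =>
      cases t
      · simp at h
      · have := h' 0
        simp [bBlock] at this
  | cons t u ih =>
    cases v with
    | nil =>
      cases t
      · simp at h
      · have := h' 0
        simp [bBlock] at this
    | cons t' v =>
      have h₀ := h' 0
      cases t <;> cases t' <;> simp [bBlock] at h h₀
      · rw [ih h fun k => h' (k + 1)]
      · rw [ih h fun k => ?_]
        cases k with
        | zero => exact h₀
        | succ k => exact h' (k + 1)

theorem eq_replicate_b {w : List Letter} (h : w.count .a = 0) :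
    w = List.replicate w.length .b := by
  refine List.eq_replicate_iff.2 ⟨rfl, fun t ht => ?_⟩
  cases t
  · exact absurd ht (List.count_eq_zero.1 h)
  · rfl

theorem bBlock_append_replicate_b (l : List Letter) (x k : ℕ) :
    bBlock (l ++ List.replicate x .b) k = bBlock l k + if k = l.count .a then x else 0 := by
  rw [bBlock_append, bBlock_replicate_b]
  split_ifs <;> omega

theorem monotone_bBlock_take (w : List Letter) (k : ℕ) :
    Monotone fun x => bBlock (w.take x) k := by
  intro x y hxy
  obtain ⟨t, ht⟩ := List.take_prefix_take_left (l := w) hxy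
  simp only [← ht, bBlock_append]
  omega

theorem monotone_count_take (w : List Letter) : Monotone fun x => (w.take x).count .a :=
  fun _ _ hxy => (List.take_sublist_take_left hxy).count_le _

theorem bBlock_take_succ_le (w : List Letter) (k x : ℕ) :
    bBlock (w.take (x + 1)) k ≤ bBlock (w.take x) k + 1 := by
  have h : ∀ t j, bBlock [t] j ≤ 1 := by
    intro t j
    cases t <;> cases j <;> simp [bBlock]
  rw [List.take_add_one, bBlock_append]
  rcases w[x]? with _ | t
  · simp [bBlock]
  · have := h t (k - (w.take x).count .a)
    simp only [Option.toList_some]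
    split_ifs <;> omega

/-- A long block of `b`s that is met by two nested nodes with the same label, between which the
yield has no `a` and no `b` of the blocks in `X`. -/
theorem exists_block_pump (g : ContextFreeGrammar Letter) : ∃ F : ℕ → ℕ,
    ∀ (d : DerivationTree g) (w : List Letter), d.yield = w → ∀ (c : ℕ) (X : Finset ℕ),
    F (w.count .a + ∑ k ∈ X, bBlock w k) < bBlock w c →
    ∃ (A : g.NT) (x y i j : ℕ), (A, i, j) ∈ d.spans .a 0 ∧
      HasContext .a g [Symbol.nonterminal A] A (List.replicate x .b) (List.replicate y .b) ∧
      i ≤ j ∧ x ≤ bBlock w i ∧ y ≤ bBlock w j ∧ (0 < x → i ∉ X) ∧ (0 < y → j ∉ X) ∧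
      (0 < x ∧ i = c ∨ 0 < y ∧ j = c) := by
  obtain ⟨F, hF⟩ := exists_pump_of_lt g .a
  refine ⟨F, fun d w hw c X h => ?_⟩
  -- The distinguished positions are the `b`s of block `c`; the excluded ones are all `a`s and the
  -- `b`s of the blocks in `X`.
  obtain ⟨A, l, α, m, β, r, h₁, h₂, h₃, h₄, h₅, h₆⟩ := hF (fun x => bBlock (w.take x) c)
    (fun x => (w.take x).count .a + ∑ k ∈ X, bBlock (w.take x) k) (monotone_bBlock_take w c)
    ((monotone_count_take w).add fun x y hxy =>
      Finset.sum_le_sum fun k _ => monotone_bBlock_take w k hxy)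
    (bBlock_take_succ_le w c) (by simp [bBlock]) (by simp [bBlock]) d
    (by simpa [hw] using h)
  have t₁ : w.take (0 + l.length) = l := by simp [← hw, h₁]
  have t₂ : w.take (0 + (l ++ α).length) = l ++ α := by
    rw [zero_add, ← hw, h₁, List.append_assoc, List.append_assoc, List.take_left]
  have t₃ : w.take (0 + (l ++ α ++ m).length) = l ++ α ++ m := by
    rw [zero_add, ← hw, h₁, List.append_assoc _ β, List.take_left]
  have t₄ : w.take (0 + (l ++ α ++ m ++ β).length) = l ++ α ++ m ++ β := by
    rw [zero_add, ← hw, h₁, List.take_left]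
  simp only [t₁, t₂, t₃, t₄] at h₄ h₅ h₆
  -- A factor without excluded positions is a power of `b` and, unless empty, sits in a block
  -- outside `X`.
  have key : ∀ u v : List Letter, (u ++ v).count .a + ∑ k ∈ X, bBlock (u ++ v) k ≤
      u.count .a + ∑ k ∈ X, bBlock u k →
      v = List.replicate v.length .b ∧ (0 < v.length → u.count .a ∉ X) := by
    intro u v huv
    have hle : ∑ k ∈ X, bBlock u k ≤ ∑ k ∈ X, bBlock (u ++ v) k :=
      Finset.sum_le_sum fun k _ => by rw [bBlock_append]; omega
    rw [List.count_append] at huv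
    have hv : v = List.replicate v.length .b := eq_replicate_b (by omega)
    refine ⟨hv, fun hpos hX => ?_⟩
    rw [hv] at huv
    simp only [bBlock_append_replicate_b, Finset.sum_add_distrib, Finset.sum_ite_eq', hX,
      if_true] at huv
    omega
  obtain ⟨hα, hαX⟩ := key l α h₄
  obtain ⟨hβ, hβX⟩ := key (l ++ α ++ m) β h₅
  have hcα : α.count .a = 0 := by rw [hα, count_replicate_b]
  have hi : (l ++ α).count .a = l.count .a := by simp [hcα]
  have hj : (l ++ α ++ m).count .a = l.count .a + m.count .a := by simp [hcα]
  have h₂ := h₂ 0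
  rw [hα, hβ, bBlock_append_replicate_b, bBlock_append_replicate_b, ← hα, hj] at h₆
  rw [hα, hβ] at h₃
  rw [hi] at h₂
  rw [hj] at hβX
  refine ⟨A, α.length, β.length, l.count .a, l.count .a + m.count .a, by simpa using h₂, h₃,
    Nat.le_add_right _ _, ?_, ?_, hαX, hβX, ?_⟩
  · have : bBlock (l ++ α) (l.count .a) = bBlock l (l.count .a) + α.length := by
      rw [hα, bBlock_append_replicate_b]; simp
    rw [← hw, h₁, bBlock_append, bBlock_append, bBlock_append]
    omega
  · have : bBlock (l ++ α ++ m ++ β) (l.count .a + m.count .a) =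
        bBlock (l ++ α ++ m) (l.count .a + m.count .a) + β.length := by
      rw [hβ, bBlock_append_replicate_b, hj]; simp
    rw [← hw, h₁, bBlock_append]
    omega
  · split_ifs at h₆ <;> omega

/-- The word `b^p a b^q a b^r a b^s a`. -/
def word (p q r s : ℕ) : List Letter :=
  List.replicate p .b ++ [.a] ++ List.replicate q .b ++ [.a] ++ List.replicate r .b ++ [.a] ++
    List.replicate s .b ++ [.a]

theorem count_word (p q r s : ℕ) : (word p q r s).count .a = 4 := by simp [word]

theorem bBlock_singleton_a (k : ℕ) : bBlock [.a] k = 0 := by cases k <;> simp [bBlock]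

theorem bBlock_word (p q r s k : ℕ) : bBlock (word p q r s) k =
    if k = 0 then p else if k = 1 then q else if k = 2 then r else if k = 3 then s else 0 := by
  simp only [word, bBlock_append, bBlock_singleton_a, bBlock_replicate_b, List.count_append,
    count_replicate_b, List.count_singleton]
  simp
  split_ifs <;> omega

/-- Insertion of `b`s into the blocks `i` and `j` around a node with that span. -/
theorem exists_insert_word {g : ContextFreeGrammar Letter} (d : DerivationTree g)
    {p q r s : ℕ} (hd : d.yield = word p q r s) {A : g.NT} {i j x y : ℕ}
    (hA : (A, i, j) ∈ d.spans .a 0)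
    (h : HasContext .a g [Symbol.nonterminal A] A (List.replicate x .b) (List.replicate y .b))
    (hx : x ≤ bBlock (word p q r s) i) (hy : y ≤ bBlock (word p q r s) j) (t : ℕ) :
    ∃ d' : DerivationTree g, d.spans .a 0 ⊆ d'.spans .a 0 ∧ d'.yield =
      word (p + t * ((if i = 0 then x else 0) + if j = 0 then y else 0))
        (q + t * ((if i = 1 then x else 0) + if j = 1 then y else 0))
        (r + t * ((if i = 2 then x else 0) + if j = 2 then y else 0))
        (s + t * ((if i = 3 then x else 0) + if j = 3 then y else 0)) := by
  obtain ⟨d', l, m, r', h₁, h₂, h₃, h₄, h₅⟩ :=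
    (h.iterate t).insert (count_replicate_b _) (count_replicate_b _) d hA
  refine ⟨d', h₅, ?_⟩
  have hb : ∀ k, bBlock d'.yield k = bBlock d.yield k +
      (if i = k then t * x else 0) + if j = k then t * y else 0 := by
    intro k
    subst h₄ h₃
    rw [h₁, h₂]
    simp only [bBlock_append, bBlock_replicate_b, List.count_append, count_replicate_b]
    simp
    split_ifs <;> omega
  rw [hd] at hb
  refine eq_of_bBlock_eq ?_ fun k => ?_
  · rw [count_word, h₂, ← count_word p q r s, ← hd, h₁]
    simp
  · rw [hb k, bBlock_word, bBlock_word]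
    rw [bBlock_word] at hx hy
    by_cases h4 : k < 4
    · interval_cases k <;> simp [mul_add, add_assoc]
    · have hx' : i = k → x = 0 := by
        rintro rfl
        split_ifs at hx <;> omega
      have hy' : j = k → y = 0 := by
        rintro rfl
        split_ifs at hy <;> omega
      have hi : (if i = k then t * x else 0) = 0 := by
        split_ifs with hi
        · simp [hx' hi]
        · rfl
      have hj : (if j = k then t * y else 0) = 0 := by
        split_ifs with hj
        · simp [hy' hj]
        · rfl
      rw [hi, hj]
      split_ifs <;> omega

/-! ### Membership in the language as linear equations. -/

theorem mem_langAB_pow (n : ℕ) (w : List Letter) : w ∈ langAB ^ n ↔ w.length = n := by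
  induction n generalizing w with
  | zero => simp [Language.mem_one]
  | succ n ih =>
    rw [pow_succ', Language.mem_mul]
    constructor
    · rintro ⟨u, hu, v, hv, rfl⟩
      have hu : u.length = 1 := by
        rcases hu with rfl | rfl <;> rfl
      rw [List.length_append, hu, (ih v).1 hv, add_comm]
    · intro hw
      cases w with
      | nil => simp at hw
      | cons t w =>
        refine ⟨[t], ?_, w, (ih w).2 (by simpa using hw), rfl⟩
        cases t
        · exact Or.inl rfl
        · exact Or.inr rfl

theorem mem_langL {w : List Letter} : w ∈ langL ↔ ∃ u v z : List Letter,
    w = u ++ [.a] ++ v ++ [.a] ++ z ∧ v.length = u.length + z.length := by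
  constructor
  · rintro ⟨k, n, hkn, hw⟩
    simp only [Language.mem_mul, mem_langAB_pow] at hw
    obtain ⟨_, ⟨_, ⟨_, ⟨u, hu, _, rfl, rfl⟩, v, hv, rfl⟩, _, rfl, rfl⟩, z, hz, rfl⟩ := hw
    exact ⟨u, v, z, rfl, by omega⟩
  · rintro ⟨u, v, z, rfl, h⟩
    refine ⟨u.length, v.length, by omega, ?_⟩
    simp only [Language.mem_mul, mem_langAB_pow]
    exact ⟨_, ⟨_, ⟨_, ⟨u, rfl, _, rfl, rfl⟩, v, rfl, rfl⟩, _, rfl, rfl⟩, z, by omega, rfl⟩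

theorem word_mem_langL_of_add_eq {p q r s : ℕ} (h : q + r = p + s) : word p q r s ∈ langL :=
  mem_langL.2 ⟨List.replicate p .b, List.replicate q .b ++ [.a] ++ List.replicate r .b,
    List.replicate s .b ++ [.a], by simp [word], by simp; omega⟩

theorem word_mem_langL_of_add_eq' {p q r s : ℕ} (h : r + s = p + q) : word p q r s ∈ langL :=
  mem_langL.2 ⟨List.replicate p .b ++ [.a] ++ List.replicate q .b,
    List.replicate r .b ++ [.a] ++ List.replicate s .b, [], by simp [word], by simp; omega⟩

theorem length_of_word_eq {p q r s : ℕ} {u v : List Letter}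
    (h : word p q r s = u ++ [.a] ++ v) : u.length = p ∨ u.length = p + q + 1 ∨
      u.length = p + q + r + 2 ∨ u.length = p + q + r + s + 3 := by
  have h₁ : (word p q r s)[u.length]? = some .a := by simp [h]
  have step : ∀ (x : ℕ) (w : List Letter) (k : ℕ),
      (List.replicate x Letter.b ++ Letter.a :: w)[k]? = some .a →
      k = x ∨ ∃ k', k = x + 1 + k' ∧ w[k']? = some .a := by
    intro x w k hk
    rcases lt_trichotomy k x with hlt | rfl | hlt
    · rw [List.getElem?_append_left (by simpa using hlt)] at hk
      simp [hlt] at hk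
    · exact Or.inl rfl
    · obtain ⟨k', rfl⟩ := Nat.exists_eq_add_of_le (Nat.succ_le_of_lt hlt)
      refine Or.inr ⟨k', rfl, ?_⟩
      rw [List.getElem?_append_right (by simp; omega)] at hk
      simpa [show x.succ + k' - x = k' + 1 by omega] using hk
  simp only [word, List.append_assoc, List.singleton_append] at h₁
  rcases step _ _ _ h₁ with h | ⟨k₁, e₁, h⟩
  · omega
  rcases step _ _ _ h with h | ⟨k₂, e₂, h⟩
  · omega
  rcases step _ _ _ h with h | ⟨k₃, e₃, h⟩
  · omega
  rcases step _ _ _ h with h | ⟨k₄, e₄, h⟩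
  · omega
  · simp at h

/-- One equation for each pair of `a`s that can be the two chosen ones, in the order 13, 24, 12, 23,
34, 14. -/
theorem add_eq_of_word_mem_langL {p q r s : ℕ} (h : word p q r s ∈ langL) :
    q + r = p + s ∨ r + s = p + q ∨ q = p + r + s + 2 ∨ r = p + q + s + 2 ∨
      s = p + q + r + 2 ∨ p = q + r + s + 2 := by
  obtain ⟨u, v, z, hw, hl⟩ := mem_langL.1 h
  have h₁ := length_of_word_eq (u := u) (v := v ++ [.a] ++ z) (by simpa using hw)
  have h₂ := length_of_word_eq (u := u ++ [.a] ++ v) (v := z) hw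
  have h₃ := congrArg List.length hw
  simp only [word, List.length_append, List.length_replicate, List.length_singleton] at h₂ h₃
  omega

/-- If a word far out on a ray is in the language, then one of the equations that define membership
holds along the whole ray. -/
theorem direction_of_word_mem_langL {p q r s t v₀ v₁ v₂ v₃ : ℕ} (ht : p + q + r + s + 2 < t)
    (h : word (p + t * v₀) (q + t * v₁) (r + t * v₂) (s + t * v₃) ∈ langL) :
    q + r = p + s ∧ v₁ + v₂ = v₀ + v₃ ∨ r + s = p + q ∧ v₂ + v₃ = v₀ + v₁ ∨
      q = p + r + s + 2 ∨ r = p + q + s + 2 ∨ s = p + q + r + 2 ∨ p = q + r + s + 2 := by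
  -- The constant term of each equation is a multiple of `t` of absolute value less than `t`, hence
  -- zero.
  have key : ∀ c z : ℤ, c + t * z = 0 → |c| < t → c = 0 ∧ z = 0 := by
    intro c z hcz hc
    have hc₀ : c = 0 := Int.eq_zero_of_abs_lt_dvd ⟨-z, by linarith⟩ hc
    refine ⟨hc₀, ?_⟩
    rw [hc₀, zero_add] at hcz
    exact (mul_eq_zero.1 hcz).resolve_left (by omega)
  have h' := add_eq_of_word_mem_langL h
  zify at h'
  rcases h' with h' | h' | h' | h' | h' | h'
  · have := key (q + r - p - s) (v₁ + v₂ - v₀ - v₃) (by linarith) (by rw [abs_lt]; omega)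
    omega
  · have := key (r + s - p - q) (v₂ + v₃ - v₀ - v₁) (by linarith) (by rw [abs_lt]; omega)
    omega
  · have := key (q - p - r - s - 2) (v₁ - v₀ - v₂ - v₃) (by linarith) (by rw [abs_lt]; omega)
    omega
  · have := key (r - p - q - s - 2) (v₂ - v₀ - v₁ - v₃) (by linarith) (by rw [abs_lt]; omega)
    omega
  · have := key (s - p - q - r - 2) (v₃ - v₀ - v₁ - v₂) (by linarith) (by rw [abs_lt]; omega)
    omega
  · have := key (p - q - r - s - 2) (v₀ - v₁ - v₂ - v₃) (by linarith) (by rw [abs_lt]; omega)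
    omega

/-! ### Two pumps in one tree. -/

section

variable {g : ContextFreeGrammar Letter} (hg : g.language = langL)
include hg

/-- The block vector of a pump in a tree of `b^p a b^q a b^r a b^s a` satisfies the equations that
the word satisfies. -/
theorem pump_direction (d : DerivationTree g) {p q r s : ℕ} (hd : d.yield = word p q r s)
    {A : g.NT} {i j x y : ℕ} (hA : (A, i, j) ∈ d.spans .a 0)
    (h : HasContext .a g [Symbol.nonterminal A] A (List.replicate x .b) (List.replicate y .b))
    (hx : x ≤ bBlock (word p q r s) i) (hy : y ≤ bBlock (word p q r s) j)
    (hq : q ≠ p + r + s + 2) (hr : r ≠ p + q + s + 2) (hs : s ≠ p + q + r + 2)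
    (hp : p ≠ q + r + s + 2) :
    q + r = p + s ∧ ((if i = 1 then x else 0) + if j = 1 then y else 0) +
        ((if i = 2 then x else 0) + if j = 2 then y else 0) =
      ((if i = 0 then x else 0) + if j = 0 then y else 0) +
        ((if i = 3 then x else 0) + if j = 3 then y else 0) ∨
    r + s = p + q ∧ ((if i = 2 then x else 0) + if j = 2 then y else 0) +
        ((if i = 3 then x else 0) + if j = 3 then y else 0) =
      ((if i = 0 then x else 0) + if j = 0 then y else 0) +
        ((if i = 1 then x else 0) + if j = 1 then y else 0) := by
  obtain ⟨d', -, hd'⟩ := exists_insert_word d hd hA h hx hy (p + q + r + s + 3)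
  have hmem := yield_mem_language d'
  rw [hg, hd'] at hmem
  have := direction_of_word_mem_langL (by omega) hmem
  tauto

end

section

variable {g : ContextFreeGrammar Letter} (hg : g.language = langL)
include hg

/-- In a tree of `b^p a b^q a b^r a b^s a` with `q + r = p + s` and long blocks, the first and the
second block can be pumped together. -/
theorem exists_pump_first_second {F : ℕ → ℕ} (hF : ∀ (d : DerivationTree g) (w : List Letter),
    d.yield = w → ∀ (c : ℕ) (X : Finset ℕ),
    F (w.count .a + ∑ k ∈ X, bBlock w k) < bBlock w c →
    ∃ (A : g.NT) (x y i j : ℕ), (A, i, j) ∈ d.spans .a 0 ∧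
      HasContext .a g [Symbol.nonterminal A] A (List.replicate x .b) (List.replicate y .b) ∧
      i ≤ j ∧ x ≤ bBlock w i ∧ y ≤ bBlock w j ∧ (0 < x → i ∉ X) ∧ (0 < y → j ∉ X) ∧
      (0 < x ∧ i = c ∨ 0 < y ∧ j = c))
    (d : DerivationTree g) {p q r s : ℕ} (hd : d.yield = word p q r s)
    (h₁ : q + r = p + s) (h₂ : r + s ≠ p + q) (hq : q ≠ p + r + s + 2) (hr : r ≠ p + q + s + 2)
    (hs : s ≠ p + q + r + 2) (hp : p ≠ q + r + s + 2) (hFp : F 4 < p) (hFq : F (4 + p + r) < q) :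
    ∃ (A : g.NT) (x : ℕ), 0 < x ∧ x ≤ p ∧ (A, 0, 1) ∈ d.spans .a 0 ∧
      HasContext .a g [Symbol.nonterminal A] A (List.replicate x .b) (List.replicate x .b) := by
  obtain ⟨A, x, y, i, j, hA, hctx, hij, hx, hy, hxX, hyX, hc⟩ := hF d _ hd 1 {0, 2} (by
    simpa [count_word, bBlock_word, ← add_assoc] using hFq)
  have hdir := pump_direction hg d hd hA hctx hx hy hq hr hs hp
  simp only [Finset.mem_insert, Finset.mem_singleton] at hxX hyX
  -- The increments of the blocks 0 and 2 vanish, so the equation makes those of 1 and 3 equal.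
  have h13 : i = 1 ∧ j = 3 := by
    split_ifs at hdir <;> omega
  obtain ⟨A', x', y', i', j', hA', hctx', hij', hx', hy', -, -, hc'⟩ := hF d _ hd 0 ∅ (by
    simpa [count_word, bBlock_word] using hFp)
  have hdir' := pump_direction hg d hd hA' hctx' hx' hy' hq hr hs hp
  rw [h13.1, h13.2] at hA
  -- The equation allows block 0 to be paired with 1 or 2; the span (0, 2) would cross (1, 3).
  have hcross := not_crossing .a d hA' hA
  have h01 : i' = 0 ∧ j' = 1 ∧ 0 < x' ∧ y' = x' := by
    split_ifs at hdir' <;> omega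
  obtain ⟨rfl, rfl, hpos, rfl⟩ := h01
  exact ⟨A', y', hpos, by simpa [bBlock_word] using hx', hA', hctx'⟩

/-- In a tree of `b^p a b^q a b^r a b^s a` with `r + s = p + q` and long blocks, the first and the
fourth block can be pumped together. -/
theorem exists_pump_first_fourth {F : ℕ → ℕ} (hF : ∀ (d : DerivationTree g) (w : List Letter),
    d.yield = w → ∀ (c : ℕ) (X : Finset ℕ),
    F (w.count .a + ∑ k ∈ X, bBlock w k) < bBlock w c →
    ∃ (A : g.NT) (x y i j : ℕ), (A, i, j) ∈ d.spans .a 0 ∧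
      HasContext .a g [Symbol.nonterminal A] A (List.replicate x .b) (List.replicate y .b) ∧
      i ≤ j ∧ x ≤ bBlock w i ∧ y ≤ bBlock w j ∧ (0 < x → i ∉ X) ∧ (0 < y → j ∉ X) ∧
      (0 < x ∧ i = c ∨ 0 < y ∧ j = c))
    (d : DerivationTree g) {p q r s : ℕ} (hd : d.yield = word p q r s)
    (h₁ : q + r ≠ p + s) (h₂ : r + s = p + q) (hq : q ≠ p + r + s + 2) (hr : r ≠ p + q + s + 2)
    (hs : s ≠ p + q + r + 2) (hp : p ≠ q + r + s + 2) (hFp : F 4 < p) (hFq : F (4 + p + r) < q) :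
    ∃ (A : g.NT) (x : ℕ), 0 < x ∧ x ≤ p ∧ (A, 0, 3) ∈ d.spans .a 0 ∧
      HasContext .a g [Symbol.nonterminal A] A (List.replicate x .b) (List.replicate x .b) := by
  obtain ⟨A, x, y, i, j, hA, hctx, hij, hx, hy, hxX, hyX, hc⟩ := hF d _ hd 1 {0, 2} (by
    simpa [count_word, bBlock_word, ← add_assoc] using hFq)
  have hdir := pump_direction hg d hd hA hctx hx hy hq hr hs hp
  simp only [Finset.mem_insert, Finset.mem_singleton] at hxX hyX
  have h13 : i = 1 ∧ j = 3 := by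
    split_ifs at hdir <;> omega
  obtain ⟨A', x', y', i', j', hA', hctx', hij', hx', hy', -, -, hc'⟩ := hF d _ hd 0 ∅ (by
    simpa [count_word, bBlock_word] using hFp)
  have hdir' := pump_direction hg d hd hA' hctx' hx' hy' hq hr hs hp
  rw [h13.1, h13.2] at hA
  -- Here the equation allows the partners 2 and 3, and 2 is again excluded by crossing.
  have hcross := not_crossing .a d hA' hA
  have h03 : i' = 0 ∧ j' = 3 ∧ 0 < x' ∧ y' = x' := by
    split_ifs at hdir' <;> omega
  obtain ⟨rfl, rfl, hpos, rfl⟩ := h03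
  exact ⟨A', y', hpos, by simpa [bBlock_word] using hx', hA', hctx'⟩

theorem not_isUnambiguous_of_language_eq_langL : ¬ g.IsUnambiguous := by
  intro hU
  obtain ⟨F, hF⟩ := exists_block_pump g
  obtain ⟨n, hn⟩ : ∃ n, n = F 4 + 1 := ⟨_, rfl⟩
  -- The pump sizes are at most `n`, hence divide `K`, whatever trees they come from.
  obtain ⟨K, hK⟩ : ∃ K, K = n.factorial := ⟨_, rfl⟩
  -- Large enough for a pump in the second block with the blocks 0 and 2 excluded, and to rule out
  -- the degenerate equations.
  obtain ⟨z, hz⟩ : ∃ z, z = F (4 + n + (n + K)) + 4 * n + K + 3 := ⟨_, rfl⟩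
  have hKpos : 0 < K := hK ▸ n.factorial_pos
  have tree : ∀ w ∈ langL, ∃ d : DerivationTree g, d.yield = w := fun w hw =>
    (hU w (hg ▸ hw)).exists
  obtain ⟨d₁, hd₁⟩ := tree (word n z (n + K) (z + K)) (word_mem_langL_of_add_eq (by omega))
  obtain ⟨d₂, hd₂⟩ := tree (word n (z + K) (n + K) z) (word_mem_langL_of_add_eq' (by omega))
  obtain ⟨A₁, x₁, hx₁, hxn₁, hA₁, hctx₁⟩ := exists_pump_first_second hg hF d₁ hd₁ (by omega)
    (by omega) (by omega) (by omega) (by omega) (by omega) (by omega) (by omega)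
  obtain ⟨A₂, x₂, hx₂, hxn₂, hA₂, hctx₂⟩ := exists_pump_first_fourth hg hF d₂ hd₂ (by omega)
    (by omega) (by omega) (by omega) (by omega) (by omega) (by omega) (by omega)
  obtain ⟨t₁, ht₁⟩ : x₁ ∣ K := hK ▸ Nat.dvd_factorial hx₁ hxn₁
  obtain ⟨t₂, ht₂⟩ : x₂ ∣ K := hK ▸ Nat.dvd_factorial hx₂ hxn₂
  rw [mul_comm] at ht₁ ht₂
  obtain ⟨e₁, hs₁, he₁⟩ := exists_insert_word d₁ hd₁ hA₁ hctx₁ (by simp [bBlock_word]; omega)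
    (by simp [bBlock_word]; omega) t₁
  obtain ⟨e₂, hs₂, he₂⟩ := exists_insert_word d₂ hd₂ hA₂ hctx₂ (by simp [bBlock_word]; omega)
    (by simp [bBlock_word]; omega) t₂
  simp [← ht₁] at he₁
  simp [← ht₂] at he₂
  -- Both trees now yield W(n+K,z+K,n+K,z+K), so the nodes of both pumps lie in one tree.
  obtain rfl : e₁ = e₂ := (hU _ (yield_mem_language e₁)).unique rfl (he₂.trans he₁.symm)
  obtain ⟨f, hsf, hf⟩ := exists_insert_word e₁ he₁ (hs₁ hA₁) hctx₁ (by simp [bBlock_word]; omega)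
    (by simp [bBlock_word]; omega) 1
  simp at hf
  obtain ⟨f', -, hf'⟩ := exists_insert_word f hf (hsf (hs₂ hA₂)) hctx₂
    (by simp [bBlock_word]; omega) (by simp [bBlock_word]; omega) 1
  simp at hf'
  have hmem := yield_mem_language f'
  rw [hg, hf'] at hmem
  -- The exponents have grown by (x₁+x₂, x₁, 0, x₂), so the two main equations fail by 2x₂ and 2x₁.
  have := add_eq_of_word_mem_langL hmem
  omega

end

/-! ### The language is context-free. -/

namespace ContextFreeGrammar

/-- The concatenation of the languages of the symbols of a sentential form, if the language of each
nonterminal is given. -/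
def formLanguage {T N : Type*} (I : N → Language T) : List (Symbol T N) → Language T
  | [] => 1
  | .terminal t :: s => {[t]} * formLanguage I s
  | .nonterminal A :: s => I A * formLanguage I s

theorem formLanguage_append {T N : Type*} (I : N → Language T) (u v : List (Symbol T N)) :
    formLanguage I (u ++ v) = formLanguage I u * formLanguage I v := by
  induction u with
  | nil => simp [formLanguage]
  | cons x u ih => cases x <;> simp [formLanguage, ih, mul_assoc]

theorem mem_formLanguage_map_terminal {T N : Type*} (I : N → Language T) (w : List T) :
    w ∈ formLanguage I (w.map Symbol.terminal) := by
  induction w with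
  | nil => exact Language.nil_mem_one
  | cons t w ih => exact ⟨[t], rfl, w, ih, rfl⟩

/-- The languages of the nonterminals are contained in each solution of the inequalities given by
the rules. -/
theorem language_le_of_rules {T : Type*} {g : ContextFreeGrammar T} (I : g.NT → Language T)
    (hI : ∀ r ∈ g.rules, formLanguage I r.output ≤ I r.input) : g.language ≤ I g.initial := by
  intro w hw
  -- Each derivation step can only shrink the language of the sentential form.
  have key : ∀ u v, g.Derives u v → formLanguage I v ≤ formLanguage I u := by
    intro u v h
    induction h with
    | refl => exact le_rfl
    | tail _ h ih =>
      obtain ⟨r, hr, h⟩ := h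
      obtain ⟨p, q, rfl, rfl⟩ := h.exists_parts
      refine le_trans ?_ ih
      simp only [formLanguage_append, formLanguage, mul_one]
      gcongr
      exact hI r hr
  have := key _ _ hw (mem_formLanguage_map_terminal I w)
  simpa [formLanguage] using this

end ContextFreeGrammar

/-- The words of odd length with `a` in the middle. -/
def langMiddle : Language Letter :=
  {w | ∃ u v : List Letter, w = u ++ [.a] ++ v ∧ u.length = v.length}

/-- The rules `S → X X`, `X → a` and `X → c X d` for all letters `c`, `d`, where `S` is `false` and
`X` is `true`. -/
def rulesL : Finset (ContextFreeRule Letter Bool) :=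
  {⟨false, [.nonterminal true, .nonterminal true]⟩, ⟨true, [.terminal .a]⟩,
    ⟨true, [.terminal .a, .nonterminal true, .terminal .a]⟩,
    ⟨true, [.terminal .a, .nonterminal true, .terminal .b]⟩,
    ⟨true, [.terminal .b, .nonterminal true, .terminal .a]⟩,
    ⟨true, [.terminal .b, .nonterminal true, .terminal .b]⟩}

theorem start_mem_rulesL : ⟨false, [.nonterminal true, .nonterminal true]⟩ ∈ rulesL := by
  simp [rulesL]

theorem middle_mem_rulesL : ⟨true, [.terminal .a]⟩ ∈ rulesL := by
  simp [rulesL]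

theorem extend_mem_rulesL (c d : Letter) :
    ⟨true, [.terminal c, .nonterminal true, .terminal d]⟩ ∈ rulesL := by
  cases c <;> cases d <;> simp [rulesL]

/-- The grammar with the rules `rulesL`. -/
def grammarL : ContextFreeGrammar Letter := ⟨Bool, false, rulesL⟩

/-- The languages of the nonterminals of `grammarL`. -/
def nonterminalLanguageL : Bool → Language Letter
  | false => langL
  | true => langMiddle

/-- In u a v a w with |v| = |u| + |w|, cutting v after its first |u| letters puts each `a` in the
middle of its half. -/
theorem langMiddle_mul_langMiddle : langMiddle * langMiddle = langL := by
  ext w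
  rw [mem_langL, Language.mem_mul]
  constructor
  · rintro ⟨_, ⟨u, v, rfl, h⟩, _, ⟨u', v', rfl, h'⟩, rfl⟩
    exact ⟨u, v ++ u', v', by simp, by simp; omega⟩
  · rintro ⟨u, v, z, rfl, h⟩
    refine ⟨_, ⟨u, v.take u.length, rfl, by simp; omega⟩, _,
      ⟨v.drop u.length, z, rfl, by simp; omega⟩, ?_⟩
    simp only [List.append_assoc]
    rw [← List.append_assoc (v.take _), List.take_append_drop]

theorem singleton_mul_langMiddle_mul_singleton_le (c d : Letter) :
    ({[c]} : Language Letter) * (langMiddle * {[d]}) ≤ langMiddle := by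
  rintro _ ⟨_, rfl, _, ⟨_, ⟨u, v, rfl, h⟩, _, rfl, rfl⟩, rfl⟩
  exact ⟨c :: u, v ++ [d], by simp, by simp [h]⟩

theorem formLanguage_le_of_mem_rulesL {r : ContextFreeRule Letter Bool} (hr : r ∈ rulesL) :
    formLanguage nonterminalLanguageL r.output ≤ nonterminalLanguageL r.input := by
  simp only [rulesL, Finset.mem_insert, Finset.mem_singleton] at hr
  rcases hr with rfl | rfl | rfl | rfl | rfl | rfl <;>
    simp only [formLanguage, mul_one, nonterminalLanguageL]
  · exact langMiddle_mul_langMiddle.le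
  · rintro _ rfl
    exact ⟨[], [], rfl, rfl⟩
  all_goals exact singleton_mul_langMiddle_mul_singleton_le _ _

theorem grammarL_language_le : grammarL.language ≤ langL :=
  language_le_of_rules (g := grammarL) nonterminalLanguageL
    fun _ hr => formLanguage_le_of_mem_rulesL hr

theorem grammarL_derives_middle (u : List Letter) : ∀ v : List Letter, u.length = v.length →
    grammarL.Derives [.nonterminal true] ((u ++ [Letter.a] ++ v).map .terminal) := by
  induction u with
  | nil =>
    intro v hv
    obtain rfl : v = [] := List.length_eq_zero_iff.1 hv.symm
    exact Produces.single ⟨_, middle_mem_rulesL, .head []⟩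
  | cons c u ih =>
    intro v hv
    obtain ⟨v, d, rfl⟩ : ∃ v' d, v = v' ++ [d] := by
      rcases List.eq_nil_or_concat v with rfl | ⟨v', d, rfl⟩
      · simp at hv
      · exact ⟨v', d, by simp⟩
    have h₁ : grammarL.Produces [.nonterminal true]
        [.terminal c, .nonterminal true, .terminal d] :=
      ⟨_, extend_mem_rulesL c d, .head []⟩
    have h₂ := ((ih v (by simpa using hv)).append_left [.terminal c]).append_right [.terminal d]
    simpa using h₁.trans_derives h₂

theorem langL_le_grammarL_language : langL ≤ grammarL.language := by
  rw [← langMiddle_mul_langMiddle]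
  rintro _ ⟨_, ⟨u, v, rfl, h⟩, _, ⟨u', v', rfl, h'⟩, rfl⟩
  have h₁ : grammarL.Produces [.nonterminal false] [.nonterminal true, .nonterminal true] :=
    ⟨_, start_mem_rulesL, .head []⟩
  have h₂ := (grammarL_derives_middle u v h).append_right [.nonterminal true]
  have h₃ := (grammarL_derives_middle u' v' h').append_left
    ((u ++ [Letter.a] ++ v).map .terminal)
  rw [← List.map_append] at h₃
  exact h₁.trans_derives (h₂.trans h₃)

theorem mainTheorem8 : langL.IsInherentlyAmbiguous := by
  refine ⟨⟨grammarL, le_antisymm grammarL_language_le langL_le_grammarL_language⟩, ?_⟩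
  rintro ⟨g, hU, hg⟩
  exact not_isUnambiguous_of_language_eq_langL hg hU
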